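/- Let $\lambda=\sum_{k=1}^{\infty}2^{-k}\delta_k$ be the probability measure on $\mathbb R$ with an atom of weight $2^{-k}$ at $k$ for each $k=1,2,3,\dots$, and put $\Lambda(x)=\lambda(-\infty,x]$. Functions are real-valued and $\lambda$-measurable, and are identified when equal $\lambda$-a.e. For a function $f$ let $\tilde f(x)=\operatorname{ess\,sup}_\lambda\{|f(y)|:y\ge x\}$ be its least decreasing majorant. A non-negative $\lambda$-measurable $F:\mathbb R\to[0,\infty)$ is called $\lambda$-concave if $(\Lambda(b)-\Lambda(x))(F(x)-F(a))\ge (F(b)-F(x))(\Lambda(x)-\Lambda(a))$ whenever $a\le x\le b$. The level function $f^o$ is the Radon–Nikodym derivative with respect to $\lambda$ of the least $\lambda$-concave majorant of $x\mapsto\int_{(-\infty,x]}|f|\,d\lambda$ if a finite such majorant exists, and otherwise $f^o=\sup_n(\min(|f|,n))^o$. Let $\operatorname{Int}_1(L^1_\lambda,L^\infty_\lambda)$ be the collection of exact interpolation spaces: the Banach spaces $X$, linear subspaces of $L^1_\lambda+L^\infty_\lambda$ containing $L^1_\lambda\cap L^\infty_\lambda$, such that every linear operator $T$ on $L^1_\lambda+L^\infty_\lambda$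 that maps $L^1_\lambda$ to $L^1_\lambda$ and $L^\infty_\lambda$ to $L^\infty_\lambda$ boundedly, the larger of the two operator norms being $1$, maps $X$ to $X$ with norm at most $1$. For such $X$ let $\tilde X=\{f:\tilde f\in X\}$ with $\|f\|_{\tilde X}=\|\tilde f\|_X$, and $X^o=\{f:f^o\in X\}$ with $\|f\|_{X^o}=\|f^o\|_X$. Then for every $X\in\operatorname{Int}_1(L^1_\lambda,L^\infty_\lambda)$: $\tilde X=L^\infty_\lambda$ with equivalent norms, and $X^o=L^1_\lambda$ with equivalent norms. That is, the sets coincide, and there are constants $c,C>0$ (depending on $X$) such that $c\|f\|_{L^\infty_\lambda}\le\|f\|_{\tilde X}\le C\|f\|_{L^\infty_\lambda}$ for all $f\in L^\infty_\lambda$ and $c\|f\|_{L^1_\lambda}\le\|f\|_{X^o}\le C\|f\|_{L^1_\lambda}$ for all $f\in L^1_\lambda$. -/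

import Mathlib

open MeasureTheory
open scoped ENNReal Topology

noncomputable section

/-! ### Banach spaces inside an ambient vector space, and interpolation between them -/

/-- A linear subspace of `V` with a complete norm of its own. The values of `norm` outside
`carrier` carry no meaning. -/
structure BanachSubspace (V : Type*) [AddCommGroup V] [Module ℝ V] where
  carrier : Submodule ℝ V
  norm : V → ℝ
  norm_nonneg : ∀ x ∈ carrier, 0 ≤ norm x
  norm_eq_zero : ∀ x ∈ carrier, (norm x = 0 ↔ x = 0)
  norm_smul : ∀ (c : ℝ), ∀ x ∈ carrier, norm (c • x) = |c| * norm x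
  norm_add_le : ∀ x ∈ carrier, ∀ y ∈ carrier, norm (x + y) ≤ norm x + norm y
  complete : ∀ u : ℕ → V, (∀ n, u n ∈ carrier) →
    (∀ ε > 0, ∃ N, ∀ m ≥ N, ∀ n ≥ N, norm (u m - u n) < ε) →
    ∃ v ∈ carrier, Filter.Tendsto (fun n => norm (u n - v)) Filter.atTop (𝓝 0)

section Interpolation

variable {V : Type*} [AddCommGroup V] [Module ℝ V]

/-- The linear operator `T` on `X₀ + X₁` maps each `Xⱼ` into itself with norm at most `c`. -/
def CoupleBound (X₀ X₁ : BanachSubspace V)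
    (T : ↥(X₀.carrier ⊔ X₁.carrier) →ₗ[ℝ] ↥(X₀.carrier ⊔ X₁.carrier)) (c : ℝ) : Prop :=
  (∀ x : ↥(X₀.carrier ⊔ X₁.carrier), (x : V) ∈ X₀.carrier →
    (T x : V) ∈ X₀.carrier ∧ X₀.norm (T x) ≤ c * X₀.norm x) ∧
  (∀ x : ↥(X₀.carrier ⊔ X₁.carrier), (x : V) ∈ X₁.carrier →
    (T x : V) ∈ X₁.carrier ∧ X₁.norm (T x) ≤ c * X₁.norm x)

/-- `T : (X₀, X₁) → (X₀, X₁)` is a linear operator whose norm (the larger of the norms of its two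
restrictions `Xⱼ → Xⱼ`) equals one. -/
def HasCoupleNormOne (X₀ X₁ : BanachSubspace V)
    (T : ↥(X₀.carrier ⊔ X₁.carrier) →ₗ[ℝ] ↥(X₀.carrier ⊔ X₁.carrier)) : Prop :=
  IsLeast {c : ℝ | 0 ≤ c ∧ CoupleBound X₀ X₁ T c} 1

/-- `X ∈ Int₁(X₀, X₁)`. -/
structure IsExactInterpolationSpace (X₀ X₁ X : BanachSubspace V) : Prop where
  inter_le : X₀.carrier ⊓ X₁.carrier ≤ X.carrier
  le_sum : X.carrier ≤ X₀.carrier ⊔ X₁.carrier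
  bound : ∀ T : ↥(X₀.carrier ⊔ X₁.carrier) →ₗ[ℝ] ↥(X₀.carrier ⊔ X₁.carrier),
    HasCoupleNormOne X₀ X₁ T →
    ∀ x : ↥(X₀.carrier ⊔ X₁.carrier), (x : V) ∈ X.carrier →
      (T x : V) ∈ X.carrier ∧ X.norm (T x) ≤ X.norm x

end Interpolation

/-- `L^p_μ`, `1 ≤ p ≤ ∞`, inside the space of `μ`-measurable functions modulo equality a.e. -/
def lebesgueSpace (p : ℝ≥0∞) [hp : Fact (1 ≤ p)] (μ : Measure ℝ) :
    BanachSubspace (ℝ →ₘ[μ] ℝ) where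
  carrier := Lp.LpSubmodule ℝ ℝ p μ
  norm f := (eLpNorm f p μ).toReal
  norm_nonneg _ _ := ENNReal.toReal_nonneg
  norm_eq_zero f hf := by
    have h := norm_eq_zero (a := (⟨f, hf⟩ : Lp ℝ p μ))
    rw [Lp.norm_def] at h
    exact h.trans ⟨fun e => congrArg Subtype.val e, fun e => Subtype.ext e⟩
  norm_smul c f hf := by
    have h := norm_smul c (⟨f, hf⟩ : Lp ℝ p μ)
    rw [Lp.norm_def, Lp.norm_def, Real.norm_eq_abs] at h
    exact h
  norm_add_le f hf g hg := by
    have h := norm_add_le (⟨f, hf⟩ : Lp ℝ p μ) ⟨g, hg⟩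
    rw [Lp.norm_def, Lp.norm_def, Lp.norm_def] at h
    exact h
  complete u hu hc := by
    have key : ∀ a b : Lp ℝ p μ,
        dist a b = (eLpNorm ((a : ℝ →ₘ[μ] ℝ) - (b : ℝ →ₘ[μ] ℝ) : ℝ →ₘ[μ] ℝ) p μ).toReal := by
      intro a b
      rw [dist_eq_norm, Lp.norm_def]
      rfl
    have hcs : CauchySeq (fun n => (⟨u n, hu n⟩ : Lp ℝ p μ)) := by
      rw [Metric.cauchySeq_iff]
      intro ε hε
      obtain ⟨N, hN⟩ := hc ε hε
      refine ⟨N, fun m hm n hn => ?_⟩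
      rw [key]
      exact hN m hm n hn
    obtain ⟨v, hv⟩ := cauchySeq_tendsto_of_complete hcs
    refine ⟨v, v.2, ?_⟩
    have h := tendsto_iff_dist_tendsto_zero.mp hv
    simp only [key] at h
    exact h

/-! ### The least decreasing majorant -/

/-- `f̃(x) = ess sup_μ {|f(y)| : y ≥ x}`. -/
def leastDecreasingMajorant (μ : Measure ℝ) (f : ℝ → ℝ) (x : ℝ) : ℝ≥0∞ :=
  essSup (fun y => ‖f y‖ₑ) (μ.restrict (Set.Ici x))

theorem leastDecreasingMajorant_antitone (μ : Measure ℝ) (f : ℝ → ℝ) :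
    Antitone (leastDecreasingMajorant μ f) := fun _ _ h =>
  essSup_mono_measure' (Measure.restrict_mono (Set.Ici_subset_Ici.mpr h) le_rfl)

theorem measurable_leastDecreasingMajorant (μ : Measure ℝ) (f : ℝ → ℝ) :
    Measurable (leastDecreasingMajorant μ f) :=
  (leastDecreasingMajorant_antitone μ f).measurable

/-! ### The level function -/

/-- `F` is `μ`-concave, with `Λ(x) = μ (-∞, x]`. -/
structure IsMeasureConcave (μ : Measure ℝ) (F : ℝ → ℝ) : Prop where
  nonneg : ∀ x, 0 ≤ F x
  aemeasurable : AEMeasurable F μ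
  concave : ∀ a x b : ℝ, a ≤ x → x ≤ b →
    (F b - F x) * (μ.real (Set.Iic x) - μ.real (Set.Iic a)) ≤
      (μ.real (Set.Iic b) - μ.real (Set.Iic x)) * (F x - F a)

/-- The (finite-valued) `μ`-concave majorants of `x ↦ ∫_{(-∞,x]} h dμ`. -/
def concaveMajorants (μ : Measure ℝ) (h : ℝ → ℝ≥0∞) : Set (ℝ → ℝ) :=
  {G | IsMeasureConcave μ G ∧ ∀ x, ∫⁻ y in Set.Iic x, h y ∂μ ≤ ENNReal.ofReal (G x)}

/-- The least `μ`-concave majorant of `x ↦ ∫_{(-∞,x]} h dμ`, as the pointwise infimum of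
all of them. -/
def leastConcaveMajorant (μ : Measure ℝ) (h : ℝ → ℝ≥0∞) (x : ℝ) : ℝ :=
  sInf ((fun G : ℝ → ℝ => G x) '' concaveMajorants μ h)

/-- `g` is a Radon–Nikodym derivative of the distribution function `G` with respect to `μ`. -/
def IsDensity (μ : Measure ℝ) (G : ℝ → ℝ) (g : ℝ → ℝ≥0∞) : Prop :=
  Measurable g ∧ ∀ x, ∫⁻ y in Set.Iic x, g y ∂μ = ENNReal.ofReal (G x)

open Classical in
/-- The Radon–Nikodym derivative of `G` with respect to `μ` (zero if there is none). -/
def density (μ : Measure ℝ) (G : ℝ → ℝ) : ℝ → ℝ≥0∞ :=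
  if h : ∃ g, IsDensity μ G g then h.choose else 0

theorem measurable_density (μ : Measure ℝ) (G : ℝ → ℝ) : Measurable (density μ G) := by
  unfold density
  split_ifs with h
  · exact h.choose_spec.1
  · exact measurable_zero

open Classical in
/-- The level function `f^o`: the Radon–Nikodym derivative of the least `μ`-concave majorant of
`x ↦ ∫_{(-∞,x]} |f| dμ` if that majorant is finite. Otherwise `f^o` is the increasing limit
of the level functions of the truncations `min(|f|, n)`; these have a finite majorant, namely
`n Λ`, whenever `Λ` is finite. -/
def levelFunction (μ : Measure ℝ) (f : ℝ → ℝ) : ℝ → ℝ≥0∞ :=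
  if (concaveMajorants μ (fun y => ‖f y‖ₑ)).Nonempty then
    density μ (leastConcaveMajorant μ (fun y => ‖f y‖ₑ))
  else
    fun x => ⨆ n : ℕ, density μ (leastConcaveMajorant μ (fun y => min ‖f y‖ₑ (n : ℝ≥0∞))) x

theorem measurable_levelFunction (μ : Measure ℝ) (f : ℝ → ℝ) :
    Measurable (levelFunction μ f) := by
  unfold levelFunction
  split_ifs
  · exact measurable_density _ _
  · exact Measurable.iSup fun n => measurable_density _ _

/-! ### The spaces built from the two constructions -/

/-- The class modulo equality a.e. of an a.e. finite `[0,∞]`-valued measurable function. -/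
def toClass (μ : Measure ℝ) (g : ℝ → ℝ≥0∞) (hg : Measurable g) : ℝ →ₘ[μ] ℝ :=
  AEEqFun.mk (fun x => (g x).toReal) hg.ennreal_toReal.aestronglyMeasurable

section Spaces

variable {μ : Measure ℝ}

/-- The set `X̃` of all `f` with `f̃ ∈ X`. -/
def tildeSpace (X : BanachSubspace (ℝ →ₘ[μ] ℝ)) : Set (ℝ →ₘ[μ] ℝ) :=
  {f | (∀ᵐ x ∂μ, leastDecreasingMajorant μ f x < ∞) ∧
    toClass μ (leastDecreasingMajorant μ f) (measurable_leastDecreasingMajorant μ f) ∈ X.carrier}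

/-- `‖f‖_{X̃} = ‖f̃‖_X`. -/
def tildeNorm (X : BanachSubspace (ℝ →ₘ[μ] ℝ)) (f : ℝ →ₘ[μ] ℝ) : ℝ :=
  X.norm (toClass μ (leastDecreasingMajorant μ f) (measurable_leastDecreasingMajorant μ f))

/-- The set `X^o` of all `f` with `f^o ∈ X`. -/
def levelSpace (X : BanachSubspace (ℝ →ₘ[μ] ℝ)) : Set (ℝ →ₘ[μ] ℝ) :=
  {f | (∀ᵐ x ∂μ, levelFunction μ f x < ∞) ∧
    toClass μ (levelFunction μ f) (measurable_levelFunction μ f) ∈ X.carrier}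

/-- `‖f‖_{X^o} = ‖f^o‖_X`. -/
def levelNorm (X : BanachSubspace (ℝ →ₘ[μ] ℝ)) (f : ℝ →ₘ[μ] ℝ) : ℝ :=
  X.norm (toClass μ (levelFunction μ f) (measurable_levelFunction μ f))

end Spaces

/-- The probability measure on `ℝ` with an atom of weight `2^{-k}` at `k`, for `k = 1, 2, 3, …`. -/
def dyadicMeasure : Measure ℝ :=
  Measure.sum fun k : ℕ+ => ((2 : ℝ≥0∞)⁻¹ ^ (k : ℕ)) • Measure.dirac ((k : ℕ) : ℝ)

end

/-!
The measure enters only through its finiteness and its first atom `a`. A non-negative `μ`-concave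
function `G` has `G / Λ` non-increasing, and both constructions are controlled by their value at
`a`: on the one hand `f̃(a) = ‖f‖_∞` and `f̃ ≤ ‖f‖_∞`, on the other hand
`‖f‖₁ / μ(ℝ) ≤ f^o(a)` and `f^o ≤ ‖f‖₁ / μ{a}`. An exact interpolation space `X` is invariant under
multiplication by bounded functions, so comparison with a constant, and multiplication by the
characteristic function of `{a}`, bound the `X`-norm of such a function above and below by its
value at `a`.
-/

section DistributionFunction

open Set Filter
open scoped NNReal

theorem exists_measure_Iic_eq_ofReal {F : ℝ → ℝ} (hmono : Monotone F)
    (hcont : ∀ x, ContinuousWithinAt F (Ici x) x) (hbot : Tendsto F atBot (𝓝 0)) :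
    ∃ ν : Measure ℝ, ∀ x, ν (Iic x) = ENNReal.ofReal (F x) :=
  ⟨(⟨F, hmono, hcont⟩ : StieltjesFunction ℝ).measure, fun x => by
    simpa using (⟨F, hmono, hcont⟩ : StieltjesFunction ℝ).measure_Iic hbot x⟩

theorem tendsto_setLIntegral_Iic_atTop (μ : Measure ℝ) (h : ℝ → ℝ≥0∞) :
    Tendsto (fun x => ∫⁻ y in Iic x, h y ∂μ) atTop (𝓝 (∫⁻ y, h y ∂μ)) := by
  simpa [withDensity_apply] using tendsto_measure_Iic_atTop (μ.withDensity h)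

theorem isDensity_density {μ : Measure ℝ} {G : ℝ → ℝ} (h : ∃ g, IsDensity μ G g) :
    IsDensity μ G (density μ G) := by
  rw [density, dif_pos h]
  exact h.choose_spec

variable {μ : Measure ℝ} [IsFiniteMeasure μ] {G : ℝ → ℝ} {C : ℝ≥0}

theorem monotone_measureReal_Iic (μ : Measure ℝ) [IsFiniteMeasure μ] :
    Monotone fun x => μ.real (Iic x) := fun _ _ h =>
  measureReal_mono (Iic_subset_Iic.2 h)

theorem tendsto_measureReal_Iic_atBot (μ : Measure ℝ) [IsFiniteMeasure μ] :
    Tendsto (fun x => μ.real (Iic x)) atBot (𝓝 0) := by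
  have h : Tendsto (fun x => μ (Iic x)) atBot (𝓝 (μ (⋂ x : ℝ, Iic x))) :=
    tendsto_measure_iInter_atBot (fun x => measurableSet_Iic.nullMeasurableSet) monotone_Iic
      ⟨0, measure_ne_top μ _⟩
  rw [iInter_Iic_eq_empty_iff.2 (by simp [not_bddBelow_univ]), measure_empty] at h
  exact (ENNReal.tendsto_toReal ENNReal.zero_ne_top).comp h

theorem continuousWithinAt_measureReal_Iic (μ : Measure ℝ) [IsFiniteMeasure μ] (x : ℝ) :
    ContinuousWithinAt (fun y => μ.real (Iic y)) (Ici x) x := by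
  rw [← continuousWithinAt_Ioi_iff_Ici]
  have h : Tendsto (fun y => μ (Iic y)) (𝓝[>] x) (𝓝 (μ (⋂ y > x, Iic y))) :=
    tendsto_measure_biInter_gt (fun y _ => measurableSet_Iic.nullMeasurableSet)
      (fun _ _ _ hyz => Iic_subset_Iic.2 hyz) ⟨x + 1, by simp, measure_ne_top μ _⟩
  rw [show ⋂ y > x, Iic y = Iic x by
    ext z; simp only [mem_iInter, mem_Iic]; exact forall_gt_imp_ge_iff_le_of_dense] at h
  exact (ENNReal.tendsto_toReal (measure_ne_top μ _)).comp h

theorem continuousWithinAt_of_sub_le_mul_measureReal_Iic (hmono : Monotone G)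
    (hlip : ∀ x b, x ≤ b → G b - G x ≤ C * (μ.real (Iic b) - μ.real (Iic x))) (x : ℝ) :
    ContinuousWithinAt G (Ici x) x := by
  have hupper : Tendsto (fun b => G x + C * (μ.real (Iic b) - μ.real (Iic x))) (𝓝[≥] x)
      (𝓝 (G x)) := by
    simpa using (((continuousWithinAt_measureReal_Iic μ x).sub_const
      (μ.real (Iic x))).const_mul (C : ℝ)).const_add (G x)
  refine tendsto_of_tendsto_of_tendsto_of_le_of_le' tendsto_const_nhds hupper ?_ ?_ <;>
    filter_upwards [self_mem_nhdsWithin] with b hb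
  · exact hmono hb
  · linarith [hlip x b hb]

theorem measure_le_smul_of_sub_le_mul_measureReal_Iic {ν : Measure ℝ}
    (hν : ∀ x, ν (Iic x) = ENNReal.ofReal (G x)) (hmono : Monotone G)
    (hbot : Tendsto G atBot (𝓝 0))
    (hlip : ∀ x b, x ≤ b → G b - G x ≤ C * (μ.real (Iic b) - μ.real (Iic x))) :
    ν ≤ C • μ := by
  set H : ℝ → ℝ := fun x => C * μ.real (Iic x) - G x with hH
  have hHmono : Monotone H := fun x b hxb => by
    simp only [hH]; linarith [hlip x b hxb, mul_sub (C : ℝ) (μ.real (Iic b)) (μ.real (Iic x))]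
  have hHcont (x : ℝ) : ContinuousWithinAt H (Ici x) x :=
    ((continuousWithinAt_measureReal_Iic μ x).const_mul (C : ℝ)).sub
      (continuousWithinAt_of_sub_le_mul_measureReal_Iic hmono hlip x)
  have hHbot : Tendsto H atBot (𝓝 0) := by
    simpa using ((tendsto_measureReal_Iic_atBot μ).const_mul (C : ℝ)).sub hbot
  obtain ⟨ρ, hρ⟩ := exists_measure_Iic_eq_ofReal hHmono hHcont hHbot
  have hsum : C • μ = ν + ρ := by
    refine Measure.ext_of_Iic _ _ fun x => ?_
    rw [Measure.add_apply, hν, hρ, ← ENNReal.ofReal_add (hmono.le_of_tendsto hbot x)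
      (hHmono.le_of_tendsto hHbot x), add_sub_cancel, ← measureReal_nnreal_smul_apply,
      ofReal_measureReal]
  exact hsum ▸ Measure.le_add_right le_rfl

theorem exists_isDensity_of_sub_le_mul_measureReal_Iic (hmono : Monotone G)
    (hbot : Tendsto G atBot (𝓝 0))
    (hlip : ∀ x b, x ≤ b → G b - G x ≤ C * (μ.real (Iic b) - μ.real (Iic x))) :
    ∃ g, IsDensity μ G g := by
  obtain ⟨ν, hν⟩ := exists_measure_Iic_eq_ofReal hmono
    (continuousWithinAt_of_sub_le_mul_measureReal_Iic hmono hlip) hbot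
  have hle : ν ≤ C • μ := measure_le_smul_of_sub_le_mul_measureReal_Iic hν hmono hbot hlip
  have hνfin : IsFiniteMeasure ν := isFiniteMeasure_of_le _ hle
  refine ⟨ν.rnDeriv μ, Measure.measurable_rnDeriv ν μ, fun x => ?_⟩
  rw [Measure.setLIntegral_rnDeriv (Measure.absolutelyContinuous_of_le_smul (c := C) hle), hν]

theorem IsDensity.ae_le {g : ℝ → ℝ≥0∞} (hg : IsDensity μ G g) (hmono : Monotone G)
    (hbot : Tendsto G atBot (𝓝 0))
    (hlip : ∀ x b, x ≤ b → G b - G x ≤ C * (μ.real (Iic b) - μ.real (Iic x))) :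
    ∀ᵐ x ∂μ, g x ≤ C := by
  have hle : μ.withDensity g ≤ C • μ := measure_le_smul_of_sub_le_mul_measureReal_Iic
    (fun x => by rw [withDensity_apply _ measurableSet_Iic, hg.2]) hmono hbot hlip
  refine ae_le_of_forall_setLIntegral_le_of_sigmaFinite hg.1 fun s hs _ => ?_
  simpa [withDensity_apply _ hs] using hle s

end DistributionFunction

section LeastConcaveMajorant

open Set

variable {μ : Measure ℝ} {h : ℝ → ℝ≥0∞} {G : ℝ → ℝ}

theorem const_mem_concaveMajorants {c : ℝ} (hc : 0 ≤ c)
    (hle : ∀ x, ∫⁻ y in Iic x, h y ∂μ ≤ ENNReal.ofReal c) :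
    (fun _ => c) ∈ concaveMajorants μ h :=
  ⟨⟨fun _ => hc, aemeasurable_const, fun _ _ _ _ _ => by simp⟩, hle⟩

theorem leastConcaveMajorant_nonneg (μ : Measure ℝ) (h : ℝ → ℝ≥0∞) (x : ℝ) :
    0 ≤ leastConcaveMajorant μ h x :=
  Real.sInf_nonneg (by rintro _ ⟨G, hG, rfl⟩; exact hG.1.nonneg x)

theorem leastConcaveMajorant_le (hG : G ∈ concaveMajorants μ h) (x : ℝ) :
    leastConcaveMajorant μ h x ≤ G x :=
  csInf_le ⟨0, by rintro _ ⟨F, hF, rfl⟩; exact hF.1.nonneg x⟩ ⟨G, hG, rfl⟩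

theorem le_leastConcaveMajorant (hne : (concaveMajorants μ h).Nonempty) {x c : ℝ}
    (hle : ∀ G ∈ concaveMajorants μ h, c ≤ G x) : c ≤ leastConcaveMajorant μ h x :=
  le_csInf (hne.image _) (by rintro _ ⟨G, hG, rfl⟩; exact hle G hG)

variable [IsFiniteMeasure μ]

theorem setLIntegral_Iic_eq_of_measureReal_Iic_eq {x y : ℝ} (hxy : x ≤ y)
    (heq : μ.real (Iic x) = μ.real (Iic y)) :
    ∫⁻ t in Iic x, h t ∂μ = ∫⁻ t in Iic y, h t ∂μ :=
  setLIntegral_congr <| ae_eq_of_subset_of_measure_ge (Iic_subset_Iic.2 hxy)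
    ((measureReal_eq_measureReal_iff).1 heq).ge measurableSet_Iic.nullMeasurableSet
    (measure_ne_top μ _)

theorem IsMeasureConcave.le_of_lt (hG : IsMeasureConcave μ G) {x y z : ℝ} (hxy : x ≤ y)
    (hyz : y ≤ z) (hlt : G y < G x) (hΛ : μ.real (Iic y) < μ.real (Iic z)) : G z ≤ G y := by
  have hconc := hG.concave x y z hxy hyz
  have hΛxy : μ.real (Iic x) < μ.real (Iic y) := by
    refine lt_of_le_of_ne (monotone_measureReal_Iic μ hxy) fun heq => ?_
    rw [heq, sub_self, mul_zero] at hconc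
    exact hconc.not_gt (mul_neg_of_pos_of_neg (sub_pos.2 hΛ) (sub_neg.2 hlt))
  nlinarith

theorem const_mem_concaveMajorants_of_lt (hG : G ∈ concaveMajorants μ h) {x y : ℝ} (hxy : x ≤ y)
    (hlt : G y < G x) : (fun _ => G y) ∈ concaveMajorants μ h := by
  refine const_mem_concaveMajorants (hG.1.nonneg y) fun z => ?_
  rcases le_total z y with hzy | hyz
  · exact (lintegral_mono_set (Iic_subset_Iic.2 hzy)).trans (hG.2 y)
  rcases (monotone_measureReal_Iic μ hyz).eq_or_lt with heq | hΛ
  · exact (setLIntegral_Iic_eq_of_measureReal_Iic_eq hyz heq).symm.trans_le (hG.2 y)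
  · exact (hG.2 z).trans (ENNReal.ofReal_le_ofReal (hG.1.le_of_lt hxy hyz hlt hΛ))

theorem monotone_leastConcaveMajorant : Monotone (leastConcaveMajorant μ h) := by
  intro x y hxy
  rcases (concaveMajorants μ h).eq_empty_or_nonempty with hempty | hne
  · simp [leastConcaveMajorant, hempty]
  refine le_leastConcaveMajorant hne fun G hG => ?_
  rcases le_or_gt (G x) (G y) with hle | hlt
  · exact (leastConcaveMajorant_le hG x).trans hle
  · exact leastConcaveMajorant_le (const_mem_concaveMajorants_of_lt hG hxy hlt) x

theorem concave_leastConcaveMajorant (hne : (concaveMajorants μ h).Nonempty) {a x b : ℝ}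
    (hax : a ≤ x) (hxb : x ≤ b) :
    (leastConcaveMajorant μ h b - leastConcaveMajorant μ h x) *
        (μ.real (Iic x) - μ.real (Iic a)) ≤
      (μ.real (Iic b) - μ.real (Iic x)) *
        (leastConcaveMajorant μ h x - leastConcaveMajorant μ h a) := by
  set K := leastConcaveMajorant μ h
  have hΛax : μ.real (Iic a) ≤ μ.real (Iic x) := monotone_measureReal_Iic μ hax
  have hΛxb : μ.real (Iic x) ≤ μ.real (Iic b) := monotone_measureReal_Iic μ hxb
  rcases (hΛax.trans hΛxb).eq_or_lt with heq | hlt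
  · rw [show μ.real (Iic x) = μ.real (Iic a) by linarith, heq]
    simp
  have hchord : (K a * (μ.real (Iic b) - μ.real (Iic x)) +
      K b * (μ.real (Iic x) - μ.real (Iic a))) / (μ.real (Iic b) - μ.real (Iic a)) ≤ K x := by
    refine le_leastConcaveMajorant hne fun G hG => ?_
    rw [div_le_iff₀ (sub_pos.2 hlt)]
    have hKa := mul_le_mul_of_nonneg_right (leastConcaveMajorant_le hG a) (sub_nonneg.2 hΛxb)
    have hKb := mul_le_mul_of_nonneg_right (leastConcaveMajorant_le hG b) (sub_nonneg.2 hΛax)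
    linarith [hG.1.concave a x b hax hxb]
  rw [div_le_iff₀ (sub_pos.2 hlt)] at hchord
  linarith

theorem leastConcaveMajorant_mem_concaveMajorants (hne : (concaveMajorants μ h).Nonempty) :
    leastConcaveMajorant μ h ∈ concaveMajorants μ h := by
  refine ⟨⟨leastConcaveMajorant_nonneg μ h, monotone_leastConcaveMajorant.measurable.aemeasurable,
    fun a x b => concave_leastConcaveMajorant hne⟩, fun x => ?_⟩
  obtain ⟨G, hG⟩ := hne
  have hfin : ∫⁻ y in Iic x, h y ∂μ ≠ ∞ := ne_top_of_le_ne_top ENNReal.ofReal_ne_top (hG.2 x)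
  rw [ENNReal.le_ofReal_iff_toReal_le hfin (leastConcaveMajorant_nonneg μ h x)]
  exact le_leastConcaveMajorant ⟨G, hG⟩ fun F hF =>
    ENNReal.toReal_le_of_le_ofReal (hF.1.nonneg x) (hF.2 x)

end LeastConcaveMajorant

section MeasureConcave

open Set Filter
open scoped NNReal

variable {μ : Measure ℝ} [IsFiniteMeasure μ] {G : ℝ → ℝ}

theorem IsMeasureConcave.mul_measureReal_Iic_le (hG : IsMeasureConcave μ G) {x b : ℝ}
    (hxb : x ≤ b) : G b * μ.real (Iic x) ≤ G x * μ.real (Iic b) := by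
  have hlim : Tendsto (fun a => (G b - G x) * (μ.real (Iic x) - μ.real (Iic a))) atBot
      (𝓝 ((G b - G x) * μ.real (Iic x))) := by
    simpa using ((tendsto_measureReal_Iic_atBot μ).const_sub (μ.real (Iic x))).const_mul (G b - G x)
  -- Drop `G a ≥ 0` from concavity on `a ≤ x ≤ b` and let `a → -∞`.
  have hle : (G b - G x) * μ.real (Iic x) ≤ (μ.real (Iic b) - μ.real (Iic x)) * G x := by
    refine le_of_tendsto hlim ((eventually_le_atBot x).mono fun a ha => ?_)
    refine (hG.concave a x b ha hxb).trans (mul_le_mul_of_nonneg_left ?_ ?_)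
    · exact sub_le_self _ (hG.nonneg a)
    · exact sub_nonneg.2 (monotone_measureReal_Iic μ hxb)
  linarith

theorem IsMeasureConcave.sub_le_mul_measureReal_Iic (hG : IsMeasureConcave μ G) {C : ℝ}
    (hle : ∀ x, G x ≤ C * μ.real (Iic x)) {x b : ℝ} (hxb : x ≤ b) :
    G b - G x ≤ C * (μ.real (Iic b) - μ.real (Iic x)) := by
  rcases (measureReal_nonneg (μ := μ) (s := Iic x)).eq_or_lt with hzero | hpos
  · have hx := hle x
    rw [← hzero] at hx ⊢
    linarith [hle b, hG.nonneg x]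
  · have hslope := hG.mul_measureReal_Iic_le hxb
    have hscaled :=
      mul_le_mul_of_nonneg_right (hle x) (sub_nonneg.2 (monotone_measureReal_Iic μ hxb))
    refine le_of_mul_le_mul_right ?_ hpos
    linarith

variable {h : ℝ → ℝ≥0∞} {C : ℝ≥0}

theorem tendsto_leastConcaveMajorant_atBot
    (hC : (fun x => C * μ.real (Iic x)) ∈ concaveMajorants μ h) :
    Tendsto (leastConcaveMajorant μ h) atBot (𝓝 0) :=
  squeeze_zero (leastConcaveMajorant_nonneg μ h) (leastConcaveMajorant_le hC)
    (by simpa using (tendsto_measureReal_Iic_atBot μ).const_mul (C : ℝ))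

theorem leastConcaveMajorant_sub_le (hC : (fun x => C * μ.real (Iic x)) ∈ concaveMajorants μ h)
    (x b : ℝ) (hxb : x ≤ b) : leastConcaveMajorant μ h b - leastConcaveMajorant μ h x ≤
      C * (μ.real (Iic b) - μ.real (Iic x)) :=
  (leastConcaveMajorant_mem_concaveMajorants ⟨_, hC⟩).1.sub_le_mul_measureReal_Iic
    (leastConcaveMajorant_le hC) hxb

theorem isDensity_density_leastConcaveMajorant
    (hC : (fun x => C * μ.real (Iic x)) ∈ concaveMajorants μ h) :
    IsDensity μ (leastConcaveMajorant μ h) (density μ (leastConcaveMajorant μ h)) :=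
  isDensity_density <| exists_isDensity_of_sub_le_mul_measureReal_Iic
    monotone_leastConcaveMajorant (tendsto_leastConcaveMajorant_atBot hC)
    (leastConcaveMajorant_sub_le hC)

theorem density_leastConcaveMajorant_ae_le
    (hC : (fun x => C * μ.real (Iic x)) ∈ concaveMajorants μ h) :
    ∀ᵐ x ∂μ, density μ (leastConcaveMajorant μ h) x ≤ C :=
  (isDensity_density_leastConcaveMajorant hC).ae_le monotone_leastConcaveMajorant
    (tendsto_leastConcaveMajorant_atBot hC) (leastConcaveMajorant_sub_le hC)

end MeasureConcave

/-- `a` is the first atom of `μ`: the least point charged by `μ`, with positive mass. -/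
structure IsFirstAtom (μ : Measure ℝ) (a : ℝ) : Prop where
  measure_Iio : μ (Set.Iio a) = 0
  measure_singleton_ne_zero : μ {a} ≠ 0

section FirstAtom

open Set Filter
open scoped NNReal

variable {μ : Measure ℝ} {a : ℝ}

namespace IsFirstAtom

theorem ae_le (ha : IsFirstAtom μ a) : ∀ᵐ x ∂μ, a ≤ x := by
  rw [ae_iff]
  simp only [not_le]
  exact ha.measure_Iio

theorem setLIntegral_Iic (ha : IsFirstAtom μ a) (g : ℝ → ℝ≥0∞) :
    ∫⁻ y in Iic a, g y ∂μ = g a * μ {a} := by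
  have hae : Iic a =ᵐ[μ] ({a} : Set ℝ) := by
    filter_upwards [ha.ae_le] with x hx
    exact propext (hx.ge_iff_eq')
  rw [setLIntegral_congr hae, lintegral_singleton]

theorem measure_Iic (ha : IsFirstAtom μ a) : μ (Iic a) = μ {a} := by
  simpa using ha.setLIntegral_Iic 1

theorem setLIntegral_Iic_of_lt (ha : IsFirstAtom μ a) (g : ℝ → ℝ≥0∞) {x : ℝ} (hx : x < a) :
    ∫⁻ y in Iic x, g y ∂μ = 0 :=
  setLIntegral_measure_zero _ _ (measure_mono_null (Iic_subset_Iio.2 hx) ha.measure_Iio)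

theorem leastDecreasingMajorant_apply (ha : IsFirstAtom μ a) (f : ℝ → ℝ) :
    leastDecreasingMajorant μ f a = eLpNorm f ∞ μ := by
  rw [leastDecreasingMajorant, Measure.restrict_eq_self_of_ae_mem (s := Ici a) ha.ae_le,
    eLpNorm_exponent_top, eLpNormEssSup]

theorem leastDecreasingMajorant_ae_le (ha : IsFirstAtom μ a) (f : ℝ → ℝ) :
    ∀ᵐ x ∂μ, leastDecreasingMajorant μ f x ≤ eLpNorm f ∞ μ := by
  filter_upwards [ha.ae_le] with x hx
  exact (leastDecreasingMajorant_antitone μ f hx).trans_eq (ha.leastDecreasingMajorant_apply f)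

variable [IsFiniteMeasure μ] {h : ℝ → ℝ≥0∞}

theorem mul_measureReal_Iic_mem_concaveMajorants (ha : IsFirstAtom μ a) {C : ℝ≥0}
    (hC : ∫⁻ y, h y ∂μ ≤ C * μ {a}) :
    (fun x => C * μ.real (Iic x)) ∈ concaveMajorants μ h := by
  refine ⟨⟨fun x => by positivity,
    ((monotone_measureReal_Iic μ).measurable.const_mul _).aemeasurable,
    fun b x c _ _ => le_of_eq (by ring)⟩, fun x => ?_⟩
  rcases lt_or_ge x a with hx | hx
  · simp [ha.setLIntegral_Iic_of_lt h hx]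
  · calc ∫⁻ y in Iic x, h y ∂μ ≤ ∫⁻ y, h y ∂μ := setLIntegral_le_lintegral _ _
      _ ≤ C * μ (Iic x) := hC.trans (by gcongr; exact singleton_subset_iff.2 hx)
      _ = ENNReal.ofReal (C * μ.real (Iic x)) := by
        rw [ENNReal.ofReal_mul C.coe_nonneg, ENNReal.ofReal_coe_nnreal, ofReal_measureReal]

theorem measure_singleton_mul_lintegral_le (ha : IsFirstAtom μ a) {G : ℝ → ℝ}
    (hG : G ∈ concaveMajorants μ h) :
    μ {a} * ∫⁻ y, h y ∂μ ≤ ENNReal.ofReal (G a) * μ univ := by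
  refine le_of_tendsto (ENNReal.Tendsto.const_mul (tendsto_setLIntegral_Iic_atTop μ h)
    (.inr (measure_ne_top μ _))) ((eventually_ge_atTop a).mono fun b hb => ?_)
  calc μ {a} * ∫⁻ y in Iic b, h y ∂μ ≤ μ {a} * ENNReal.ofReal (G b) := by gcongr; exact hG.2 b
    _ = ENNReal.ofReal (G b * μ.real (Iic a)) := by
      rw [ENNReal.ofReal_mul (hG.1.nonneg b), ofReal_measureReal, ha.measure_Iic, mul_comm]
    _ ≤ ENNReal.ofReal (G a * μ.real (Iic b)) :=
      ENNReal.ofReal_le_ofReal (hG.1.mul_measureReal_Iic_le hb)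
    _ ≤ ENNReal.ofReal (G a) * μ univ := by
      rw [ENNReal.ofReal_mul (hG.1.nonneg a), ofReal_measureReal]
      gcongr
      exact subset_univ _

theorem lintegral_ne_top_of_nonempty (ha : IsFirstAtom μ a)
    (hne : (concaveMajorants μ h).Nonempty) : ∫⁻ y, h y ∂μ ≠ ∞ := by
  obtain ⟨G, hG⟩ := hne
  intro htop
  have hle := ha.measure_singleton_mul_lintegral_le hG
  rw [htop, ENNReal.mul_top ha.measure_singleton_ne_zero, top_le_iff] at hle
  exact ENNReal.mul_ne_top ENNReal.ofReal_ne_top (measure_ne_top μ _) hle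

theorem exists_mul_measureReal_Iic_mem_concaveMajorants (ha : IsFirstAtom μ a)
    (hh : ∫⁻ y, h y ∂μ ≠ ∞) : ∃ C : ℝ≥0, C = (μ {a})⁻¹ * ∫⁻ y, h y ∂μ ∧
      (fun x => C * μ.real (Iic x)) ∈ concaveMajorants μ h := by
  lift (μ {a})⁻¹ * ∫⁻ y, h y ∂μ to ℝ≥0 using
    ENNReal.mul_ne_top (ENNReal.inv_ne_top.2 ha.measure_singleton_ne_zero) hh with C hC
  refine ⟨C, rfl, ha.mul_measureReal_Iic_mem_concaveMajorants ?_⟩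
  rw [hC, mul_right_comm, ENNReal.inv_mul_cancel ha.measure_singleton_ne_zero
    (measure_ne_top μ _), one_mul]

theorem density_ae_le (ha : IsFirstAtom μ a) (hh : ∫⁻ y, h y ∂μ ≠ ∞) :
    ∀ᵐ x ∂μ, density μ (leastConcaveMajorant μ h) x ≤ (μ {a})⁻¹ * ∫⁻ y, h y ∂μ := by
  obtain ⟨C, hC, hmem⟩ := ha.exists_mul_measureReal_Iic_mem_concaveMajorants hh
  exact hC ▸ density_leastConcaveMajorant_ae_le hmem

theorem inv_mul_lintegral_le_density (ha : IsFirstAtom μ a) (hh : ∫⁻ y, h y ∂μ ≠ ∞) :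
    (μ univ)⁻¹ * ∫⁻ y, h y ∂μ ≤ density μ (leastConcaveMajorant μ h) a := by
  obtain ⟨C, -, hmem⟩ := ha.exists_mul_measureReal_Iic_mem_concaveMajorants hh
  have hle := ha.measure_singleton_mul_lintegral_le
    (leastConcaveMajorant_mem_concaveMajorants ⟨_, hmem⟩)
  rw [← (isDensity_density_leastConcaveMajorant hmem).2 a, ha.setLIntegral_Iic, mul_comm,
    mul_right_comm, ENNReal.mul_le_mul_iff_left ha.measure_singleton_ne_zero
    (measure_ne_top μ _)] at hle
  rw [mul_comm, ← div_eq_mul_inv]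
  exact ENNReal.div_le_of_le_mul hle

theorem levelFunction_ae_le (ha : IsFirstAtom μ a) (f : ℝ → ℝ) :
    ∀ᵐ x ∂μ, levelFunction μ f x ≤ (μ {a})⁻¹ * ∫⁻ y, ‖f y‖ₑ ∂μ := by
  by_cases hf : ∫⁻ y, ‖f y‖ₑ ∂μ = ∞
  · simp [hf, ENNReal.mul_top (ENNReal.inv_ne_zero.2 (measure_ne_top μ {a}))]
  · obtain ⟨C, -, hmem⟩ := ha.exists_mul_measureReal_Iic_mem_concaveMajorants hf
    rw [levelFunction, if_pos ⟨_, hmem⟩]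
    exact ha.density_ae_le hf

theorem inv_mul_lintegral_le_levelFunction (ha : IsFirstAtom μ a) {f : ℝ → ℝ}
    (hf : AEMeasurable f μ) :
    (μ univ)⁻¹ * ∫⁻ y, ‖f y‖ₑ ∂μ ≤ levelFunction μ f a := by
  rw [levelFunction]
  split_ifs with hne
  · exact ha.inv_mul_lintegral_le_density (ha.lintegral_ne_top_of_nonempty hne)
  have hfin (n : ℕ) : ∫⁻ y, min ‖f y‖ₑ n ∂μ ≠ ∞ :=
    ne_top_of_le_ne_top (lintegral_const_lt_top (ENNReal.natCast_ne_top n)).ne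
      (lintegral_mono fun y => min_le_right _ _)
  have hsup (y : ℝ) : ⨆ n : ℕ, min ‖f y‖ₑ (n : ℝ≥0∞) = ‖f y‖ₑ :=
    (inf_iSup_eq _ _).symm.trans (by rw [ENNReal.iSup_natCast, inf_top_eq])
  calc (μ univ)⁻¹ * ∫⁻ y, ‖f y‖ₑ ∂μ = ⨆ n : ℕ, (μ univ)⁻¹ * ∫⁻ y, min ‖f y‖ₑ n ∂μ := by
        rw [← ENNReal.mul_iSup, ← lintegral_iSup' (fun n => hf.enorm.min aemeasurable_const)
          (ae_of_all _ fun y m n hmn => min_le_min_left _ (Nat.cast_le.2 hmn))]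
        simp only [hsup]
    _ ≤ ⨆ n : ℕ, density μ (leastConcaveMajorant μ fun y => min ‖f y‖ₑ n) a :=
      iSup_mono fun n => ha.inv_mul_lintegral_le_density (hfin n)

end IsFirstAtom

end FirstAtom

section Multiplication

variable {μ : Measure ℝ} {p : ℝ≥0∞} [Fact (1 ≤ p)] {X : BanachSubspace (ℝ →ₘ[μ] ℝ)}

theorem mem_lebesgueSpace_iff {f : ℝ →ₘ[μ] ℝ} :
    f ∈ (lebesgueSpace p μ).carrier ↔ eLpNorm f p μ < ∞ :=
  Lp.mem_Lp_iff_eLpNorm_lt_top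

theorem lebesgueSpace_norm (f : ℝ →ₘ[μ] ℝ) :
    (lebesgueSpace p μ).norm f = (eLpNorm f p μ).toReal := rfl

/-- Multiplication by a fixed class of measurable functions, as a linear operator; these are the
only operators on which the interpolation property is tested. -/
def mulOperator (m : ℝ →ₘ[μ] ℝ) : (ℝ →ₘ[μ] ℝ) →ₗ[ℝ] (ℝ →ₘ[μ] ℝ) where
  toFun f := m * f
  map_add' f g := AEEqFun.toGerm_injective <| by
    simp only [AEEqFun.mul_toGerm, AEEqFun.add_toGerm, mul_add]
  map_smul' c f := AEEqFun.induction_on₂ m f fun g hg k hk => by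
    simp only [AEEqFun.mk_mul_mk, AEEqFun.smul_mk, mul_smul_comm, RingHom.id_apply]

theorem mulOperator_apply (m f : ℝ →ₘ[μ] ℝ) : mulOperator m f = m * f := rfl

theorem eLpNorm_mul_le_eLpNorm_top_mul (m f : ℝ →ₘ[μ] ℝ) (p : ℝ≥0∞) :
    eLpNorm (m * f : ℝ →ₘ[μ] ℝ) p μ ≤ eLpNorm m ∞ μ * eLpNorm f p μ :=
  (eLpNorm_congr_ae (AEEqFun.coeFn_mul m f)).trans_le
    (eLpNorm_smul_le_eLpNorm_top_mul_eLpNorm p f.aestronglyMeasurable m)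

theorem mul_mem_lebesgueSpace {m f : ℝ →ₘ[μ] ℝ} (hm : m ∈ (lebesgueSpace ∞ μ).carrier)
    (hf : f ∈ (lebesgueSpace p μ).carrier) :
    m * f ∈ (lebesgueSpace p μ).carrier ∧ (lebesgueSpace p μ).norm (m * f) ≤
      (lebesgueSpace ∞ μ).norm m * (lebesgueSpace p μ).norm f := by
  rw [mem_lebesgueSpace_iff] at hm hf
  have hle := eLpNorm_mul_le_eLpNorm_top_mul m f p
  have hfin : eLpNorm m ∞ μ * eLpNorm f p μ < ∞ := ENNReal.mul_lt_top hm hf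
  refine ⟨mem_lebesgueSpace_iff.2 (hle.trans_lt hfin), ?_⟩
  simpa only [lebesgueSpace_norm, ENNReal.toReal_mul] using ENNReal.toReal_mono hfin.ne hle

theorem eLpNorm_one_top_le (μ : Measure ℝ) : eLpNorm (1 : ℝ →ₘ[μ] ℝ) ∞ μ ≤ 1 := by
  rw [eLpNorm_congr_ae AEEqFun.coeFn_one, eLpNorm_exponent_top]
  exact eLpNormEssSup_le_of_ae_enorm_bound (ae_of_all _ fun _ => by simp)

theorem one_mem_lebesgueSpace_top (μ : Measure ℝ) :
    (1 : ℝ →ₘ[μ] ℝ) ∈ (lebesgueSpace ∞ μ).carrier :=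
  mem_lebesgueSpace_iff.2 ((eLpNorm_one_top_le μ).trans_lt ENNReal.one_lt_top)

theorem lebesgueSpace_norm_one_top_le (μ : Measure ℝ) : (lebesgueSpace ∞ μ).norm 1 ≤ 1 :=
  ENNReal.toReal_le_of_le_ofReal zero_le_one (by simpa using eLpNorm_one_top_le μ)

namespace IsExactInterpolationSpace

theorem mul_mem_of_norm_eq_one
    (hX : IsExactInterpolationSpace (lebesgueSpace p μ) (lebesgueSpace ∞ μ) X)
    {m f : ℝ →ₘ[μ] ℝ} (hm : m ∈ (lebesgueSpace ∞ μ).carrier)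
    (hm1 : (lebesgueSpace ∞ μ).norm m = 1) (hf : f ∈ X.carrier) :
    m * f ∈ X.carrier ∧ X.norm (m * f) ≤ X.norm f := by
  have hmap : ∀ x ∈ (lebesgueSpace p μ).carrier ⊔ (lebesgueSpace ∞ μ).carrier,
      mulOperator m x ∈ (lebesgueSpace p μ).carrier ⊔ (lebesgueSpace ∞ μ).carrier := by
    intro x hx
    obtain ⟨y, hy, z, hz, rfl⟩ := Submodule.mem_sup.1 hx
    rw [map_add]
    exact Submodule.add_mem_sup (mul_mem_lebesgueSpace hm hy).1 (mul_mem_lebesgueSpace hm hz).1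
  refine hX.bound ((mulOperator m).restrict hmap)
    ⟨⟨zero_le_one, fun x hx => ?_, fun x hx => ?_⟩, ?_⟩ ⟨f, hX.le_sum hf⟩ hf
  · exact hm1 ▸ mul_mem_lebesgueSpace hm hx
  · exact hm1 ▸ mul_mem_lebesgueSpace hm hx
  · rintro c ⟨hc0, -, hc⟩
    have hone := one_mem_lebesgueSpace_top μ
    have hle : (lebesgueSpace ∞ μ).norm (m * 1) ≤ c * (lebesgueSpace ∞ μ).norm 1 :=
      (hc ⟨1, Submodule.mem_sup_right hone⟩ hone).2
    rw [mul_one, hm1] at hle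
    exact hle.trans (mul_le_of_le_one_right hc0 (lebesgueSpace_norm_one_top_le μ))

theorem mul_mem (hX : IsExactInterpolationSpace (lebesgueSpace p μ) (lebesgueSpace ∞ μ) X)
    {m f : ℝ →ₘ[μ] ℝ} (hm : m ∈ (lebesgueSpace ∞ μ).carrier) (hf : f ∈ X.carrier) :
    m * f ∈ X.carrier ∧ X.norm (m * f) ≤ (lebesgueSpace ∞ μ).norm m * X.norm f := by
  set N := (lebesgueSpace ∞ μ).norm m
  rcases ((lebesgueSpace ∞ μ).norm_nonneg m hm).eq_or_lt with hN | hN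
  · have hzero : m * f = 0 := by
      rw [((lebesgueSpace ∞ μ).norm_eq_zero m hm).1 hN.symm, mul_comm, ← mulOperator_apply,
        map_zero]
    rw [hzero, (X.norm_eq_zero 0 X.carrier.zero_mem).2 rfl]
    exact ⟨X.carrier.zero_mem, mul_nonneg hN.le (X.norm_nonneg f hf)⟩
  · have hnormalize : (lebesgueSpace ∞ μ).norm (N⁻¹ • m) = 1 := by
      rw [(lebesgueSpace ∞ μ).norm_smul _ m hm, abs_of_pos (inv_pos.2 hN),
        inv_mul_cancel₀ hN.ne']
    obtain ⟨hmem, hle⟩ := hX.mul_mem_of_norm_eq_one (Submodule.smul_mem _ N⁻¹ hm) hnormalize hf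
    have hscale : m * f = N • (N⁻¹ • m * f) := by
      rw [mul_comm (N⁻¹ • m), ← mulOperator_apply f, map_smul, smul_inv_smul₀ hN.ne',
        mulOperator_apply, mul_comm]
    rw [hscale, X.norm_smul _ _ hmem, abs_of_pos hN]
    exact ⟨X.carrier.smul_mem N hmem, mul_le_mul_of_nonneg_left hle hN.le⟩

variable [IsFiniteMeasure μ]

theorem one_mem (hX : IsExactInterpolationSpace (lebesgueSpace p μ) (lebesgueSpace ∞ μ) X) :
    1 ∈ X.carrier :=
  hX.inter_le ⟨Lp.const_mem_Lp ℝ μ 1, one_mem_lebesgueSpace_top μ⟩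

theorem mem_of_mem_top
    (hX : IsExactInterpolationSpace (lebesgueSpace p μ) (lebesgueSpace ∞ μ) X)
    {f : ℝ →ₘ[μ] ℝ} (hf : f ∈ (lebesgueSpace ∞ μ).carrier) :
    f ∈ X.carrier ∧ X.norm f ≤ (lebesgueSpace ∞ μ).norm f * X.norm 1 := by
  simpa only [mul_one] using hX.mul_mem hf hX.one_mem

end IsExactInterpolationSpace

end Multiplication

section Comparison

open Set

variable {μ : Measure ℝ}

theorem apply_of_ae_of_measure_singleton_ne_zero {a : ℝ} (ha : μ {a} ≠ 0) {P : ℝ → Prop}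
    (hP : ∀ᵐ x ∂μ, P x) : P a := by
  by_contra hPa
  exact ha (measure_mono_null (singleton_subset_iff.2 hPa) (ae_iff.1 hP))

theorem eLpNorm_toClass_top_le {g : ℝ → ℝ≥0∞} (hg : Measurable g) {B : ℝ≥0∞}
    (hB : ∀ᵐ x ∂μ, g x ≤ B) : eLpNorm (toClass μ g hg) ∞ μ ≤ B := by
  rw [toClass, eLpNorm_congr_ae (AEEqFun.coeFn_mk _ _), eLpNorm_exponent_top]
  refine eLpNormEssSup_le_of_ae_enorm_bound (hB.mono fun x hx => ?_)
  rw [Real.enorm_of_nonneg ENNReal.toReal_nonneg]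
  exact ENNReal.ofReal_toReal_le.trans hx

variable [IsFiniteMeasure μ] {p : ℝ≥0∞} [Fact (1 ≤ p)] {X : BanachSubspace (ℝ →ₘ[μ] ℝ)} {a : ℝ}

/-- The class of the characteristic function of `{a}`; multiplying by it evaluates a function at
the point `a`, which makes sense on classes when `a` is an atom. -/
noncomputable def singletonIndicator (μ : Measure ℝ) [IsFiniteMeasure μ] (a : ℝ) : ℝ →ₘ[μ] ℝ :=
  indicatorConstLp ∞ (measurableSet_singleton a) (measure_ne_top μ {a}) (1 : ℝ)

theorem singletonIndicator_mem (μ : Measure ℝ) [IsFiniteMeasure μ] (a : ℝ) :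
    singletonIndicator μ a ∈ (lebesgueSpace ∞ μ).carrier :=
  Subtype.prop _

theorem lebesgueSpace_norm_singletonIndicator (ha : μ {a} ≠ 0) :
    (lebesgueSpace ∞ μ).norm (singletonIndicator μ a) = 1 :=
  (norm_indicatorConstLp_top ha).trans norm_one

theorem singletonIndicator_mul_toClass {g : ℝ → ℝ≥0∞} (hg : Measurable g) :
    singletonIndicator μ a * toClass μ g hg = (g a).toReal • singletonIndicator μ a := by
  refine AEEqFun.ext ?_
  have hχ : singletonIndicator μ a =ᵐ[μ] indicator {a} fun _ => 1 := indicatorConstLp_coeFn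
  filter_upwards [AEEqFun.coeFn_mul (singletonIndicator μ a) (toClass μ g hg), hχ,
    AEEqFun.coeFn_mk (μ := μ) _ hg.ennreal_toReal.aestronglyMeasurable,
    AEEqFun.coeFn_smul (g a).toReal (singletonIndicator μ a)] with x hmul hχx hgx hsmul
  rw [hmul, hsmul, Pi.mul_apply, Pi.smul_apply, hχx, toClass, hgx]
  by_cases hx : x = a <;> simp [hx]

namespace IsExactInterpolationSpace

theorem norm_singletonIndicator_pos
    (hX : IsExactInterpolationSpace (lebesgueSpace p μ) (lebesgueSpace ∞ μ) X)
    (ha : μ {a} ≠ 0) : 0 < X.norm (singletonIndicator μ a) := by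
  have hmem := (hX.mem_of_mem_top (singletonIndicator_mem μ a)).1
  refine (X.norm_nonneg _ hmem).lt_of_ne' (mt (X.norm_eq_zero _ hmem).1 fun hzero => ?_)
  have hnorm := lebesgueSpace_norm_singletonIndicator ha
  rw [hzero, ((lebesgueSpace ∞ μ).norm_eq_zero 0 (Submodule.zero_mem _)).2 rfl] at hnorm
  exact zero_ne_one hnorm

theorem norm_one_pos (hX : IsExactInterpolationSpace (lebesgueSpace p μ) (lebesgueSpace ∞ μ) X)
    (ha : μ {a} ≠ 0) : 0 < X.norm 1 := by
  have hle := (hX.mem_of_mem_top (singletonIndicator_mem μ a)).2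
  rw [lebesgueSpace_norm_singletonIndicator ha, one_mul] at hle
  exact (hX.norm_singletonIndicator_pos ha).trans_le hle

theorem toReal_mul_norm_singletonIndicator_le
    (hX : IsExactInterpolationSpace (lebesgueSpace p μ) (lebesgueSpace ∞ μ) X)
    (ha : μ {a} ≠ 0) {g : ℝ → ℝ≥0∞} (hg : Measurable g) (hmem : toClass μ g hg ∈ X.carrier) :
    (g a).toReal * X.norm (singletonIndicator μ a) ≤ X.norm (toClass μ g hg) := by
  have hχ := singletonIndicator_mem μ a
  have hle := (hX.mul_mem hχ hmem).2
  rwa [lebesgueSpace_norm_singletonIndicator ha, one_mul, singletonIndicator_mul_toClass,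
    X.norm_smul _ _ (hX.mem_of_mem_top hχ).1, abs_of_nonneg ENNReal.toReal_nonneg] at hle

theorem toClass_mem_of_ae_le
    (hX : IsExactInterpolationSpace (lebesgueSpace p μ) (lebesgueSpace ∞ μ) X)
    {g : ℝ → ℝ≥0∞} (hg : Measurable g) {B : ℝ≥0∞} (hB : B ≠ ∞) (hle : ∀ᵐ x ∂μ, g x ≤ B) :
    toClass μ g hg ∈ X.carrier ∧ X.norm (toClass μ g hg) ≤ B.toReal * X.norm 1 := by
  have hbound := eLpNorm_toClass_top_le hg hle
  obtain ⟨hmem, hnorm⟩ :=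
    hX.mem_of_mem_top (mem_lebesgueSpace_iff.2 (hbound.trans_lt hB.lt_top))
  refine ⟨hmem, hnorm.trans (mul_le_mul_of_nonneg_right ?_ (X.norm_nonneg _ hX.one_mem))⟩
  exact ENNReal.toReal_mono hB hbound

theorem setOf_toClass_mem_eq_lebesgueSpace
    (hX : IsExactInterpolationSpace (lebesgueSpace p μ) (lebesgueSpace ∞ μ) X)
    (ha : μ {a} ≠ 0) {q : ℝ≥0∞} [Fact (1 ≤ q)] {Φ : (ℝ →ₘ[μ] ℝ) → ℝ → ℝ≥0∞}
    (hΦ : ∀ f, Measurable (Φ f)) {c C : ℝ≥0∞} (hc0 : c ≠ 0) (hc : c ≠ ∞) (hC0 : C ≠ 0)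
    (hC : C ≠ ∞) (hlower : ∀ f : ℝ →ₘ[μ] ℝ, c * eLpNorm f q μ ≤ Φ f a)
    (hupper : ∀ f : ℝ →ₘ[μ] ℝ, ∀ᵐ x ∂μ, Φ f x ≤ C * eLpNorm f q μ) :
    {f : ℝ →ₘ[μ] ℝ | (∀ᵐ x ∂μ, Φ f x < ∞) ∧ toClass μ (Φ f) (hΦ f) ∈ X.carrier} =
        (lebesgueSpace q μ).carrier ∧
      ∃ c > 0, ∃ C > 0, ∀ f ∈ (lebesgueSpace q μ).carrier,
        c * (lebesgueSpace q μ).norm f ≤ X.norm (toClass μ (Φ f) (hΦ f)) ∧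
        X.norm (toClass μ (Φ f) (hΦ f)) ≤ C * (lebesgueSpace q μ).norm f := by
  have hfin : ∀ f ∈ (lebesgueSpace q μ).carrier, C * eLpNorm f q μ < ∞ := fun f hf =>
    ENNReal.mul_lt_top hC.lt_top (mem_lebesgueSpace_iff.1 hf)
  have hmem f (hf : f ∈ (lebesgueSpace q μ).carrier) :=
    hX.toClass_mem_of_ae_le (hΦ f) (hfin f hf).ne (hupper f)
  have hχ := hX.norm_singletonIndicator_pos ha
  refine ⟨Set.ext fun f => ⟨fun hf => ?_, fun hf => ⟨?_, (hmem f hf).1⟩⟩,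
    c.toReal * X.norm (singletonIndicator μ a), mul_pos (ENNReal.toReal_pos hc0 hc) hχ,
    C.toReal * X.norm 1, mul_pos (ENNReal.toReal_pos hC0 hC) (hX.norm_one_pos ha),
    fun f hf => ⟨?_, ?_⟩⟩
  · have hlt := (hlower f).trans_lt (apply_of_ae_of_measure_singleton_ne_zero ha hf.1)
    exact mem_lebesgueSpace_iff.2 (ENNReal.lt_top_of_mul_ne_top_right hlt.ne hc0)
  · exact (hupper f).mono fun x hx => hx.trans_lt (hfin f hf)
  · have hΦa : Φ f a < ∞ :=
      (apply_of_ae_of_measure_singleton_ne_zero ha (hupper f)).trans_lt (hfin f hf)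
    calc c.toReal * X.norm (singletonIndicator μ a) * (lebesgueSpace q μ).norm f
        = (c * eLpNorm f q μ).toReal * X.norm (singletonIndicator μ a) := by
          rw [ENNReal.toReal_mul, lebesgueSpace_norm]; ring
      _ ≤ (Φ f a).toReal * X.norm (singletonIndicator μ a) :=
          mul_le_mul_of_nonneg_right (ENNReal.toReal_mono hΦa.ne (hlower f)) hχ.le
      _ ≤ X.norm (toClass μ (Φ f) (hΦ f)) :=
          hX.toReal_mul_norm_singletonIndicator_le ha (hΦ f) (hmem f hf).1
  · calc X.norm (toClass μ (Φ f) (hΦ f)) ≤ (C * eLpNorm f q μ).toReal * X.norm 1 := (hmem f hf).2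
      _ = C.toReal * X.norm 1 * (lebesgueSpace q μ).norm f := by
          rw [ENNReal.toReal_mul, lebesgueSpace_norm]; ring

end IsExactInterpolationSpace

end Comparison

instance : IsFiniteMeasure dyadicMeasure where
  measure_univ_lt_top := by
    rw [dyadicMeasure, Measure.sum_apply _ MeasurableSet.univ]
    simp only [Measure.smul_apply, measure_univ, smul_eq_mul, mul_one]
    rw [tsum_pnat_eq_tsum_succ (f := fun k : ℕ => (2 : ℝ≥0∞)⁻¹ ^ k),
      ENNReal.tsum_geometric_add_one, ENNReal.one_sub_inv_two, inv_inv,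
      ENNReal.inv_mul_cancel two_ne_zero ENNReal.ofNat_ne_top]
    exact ENNReal.one_lt_top

theorem isFirstAtom_dyadicMeasure : IsFirstAtom dyadicMeasure 1 where
  measure_Iio := by
    rw [dyadicMeasure, Measure.sum_apply _ measurableSet_Iio, ENNReal.tsum_eq_zero]
    simp
  measure_singleton_ne_zero := by
    rw [dyadicMeasure, Measure.sum_apply _ (measurableSet_singleton 1)]
    exact ENNReal.summable.tsum_ne_zero_iff.2 ⟨1, by simp⟩

theorem mainTheorem12_general {μ : Measure ℝ} [IsFiniteMeasure μ] {a : ℝ} (ha : IsFirstAtom μ a)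
    {p : ℝ≥0∞} [Fact (1 ≤ p)] {X : BanachSubspace (ℝ →ₘ[μ] ℝ)}
    (hX : IsExactInterpolationSpace (lebesgueSpace p μ) (lebesgueSpace ∞ μ) X) :
    (tildeSpace X = (lebesgueSpace ∞ μ).carrier ∧
      ∃ c > 0, ∃ C > 0, ∀ f ∈ (lebesgueSpace ∞ μ).carrier,
        c * (lebesgueSpace ∞ μ).norm f ≤ tildeNorm X f ∧
        tildeNorm X f ≤ C * (lebesgueSpace ∞ μ).norm f) ∧
    (levelSpace X = (lebesgueSpace 1 μ).carrier ∧
      ∃ c > 0, ∃ C > 0, ∀ f ∈ (lebesgueSpace 1 μ).carrier,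
        c * (lebesgueSpace 1 μ).norm f ≤ levelNorm X f ∧
        levelNorm X f ≤ C * (lebesgueSpace 1 μ).norm f) := by
  have hatom := ha.measure_singleton_ne_zero
  have huniv : μ Set.univ ≠ 0 := fun h => hatom (measure_mono_null (Set.subset_univ _) h)
  refine ⟨hX.setOf_toClass_mem_eq_lebesgueSpace hatom
      (fun f => measurable_leastDecreasingMajorant μ f) one_ne_zero ENNReal.one_ne_top one_ne_zero
      ENNReal.one_ne_top (fun f => ?_) fun f => ?_,
    hX.setOf_toClass_mem_eq_lebesgueSpace hatom (fun f => measurable_levelFunction μ f)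
      (ENNReal.inv_ne_zero.2 (measure_ne_top μ Set.univ)) (ENNReal.inv_ne_top.2 huniv)
      (ENNReal.inv_ne_zero.2 (measure_ne_top μ {a})) (ENNReal.inv_ne_top.2 hatom)
      (fun f => ?_) fun f => ?_⟩
  · rw [one_mul, ha.leastDecreasingMajorant_apply]
  · simpa only [one_mul] using ha.leastDecreasingMajorant_ae_le f
  · simpa only [eLpNorm_one_eq_lintegral_enorm] using
      ha.inv_mul_lintegral_le_levelFunction f.measurable.aemeasurable
  · simpa only [eLpNorm_one_eq_lintegral_enorm] using ha.levelFunction_ae_le f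

theorem mainTheorem12 (X : BanachSubspace (ℝ →ₘ[dyadicMeasure] ℝ))
    (hX : IsExactInterpolationSpace (lebesgueSpace 1 dyadicMeasure)
      (lebesgueSpace ∞ dyadicMeasure) X) :
    (tildeSpace X = (lebesgueSpace ∞ dyadicMeasure).carrier ∧
      ∃ c > 0, ∃ C > 0, ∀ f ∈ (lebesgueSpace ∞ dyadicMeasure).carrier,
        c * (lebesgueSpace ∞ dyadicMeasure).norm f ≤ tildeNorm X f ∧
        tildeNorm X f ≤ C * (lebesgueSpace ∞ dyadicMeasure).norm f) ∧
    (levelSpace X = (lebesgueSpace 1 dyadicMeasure).carrier ∧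
      ∃ c > 0, ∃ C > 0, ∀ f ∈ (lebesgueSpace 1 dyadicMeasure).carrier,
        c * (lebesgueSpace 1 dyadicMeasure).norm f ≤ levelNorm X f ∧
        levelNorm X f ≤ C * (lebesgueSpace 1 dyadicMeasure).norm f) := by
  exact mainTheorem12_general isFirstAtom_dyadicMeasure hX
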